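/- Let $f:\mathbb{R}^n\to(-\infty,+\infty]$ and $g:\mathbb{R}^m\to(-\infty,+\infty]$ be proper closed convex functions, $g^*$ the convex conjugate of $g$, $K\in\mathbb{R}^{m\times n}$, and assume that the problem $$\min_{x\in\mathbb{R}^n}\max_{y\in\mathbb{R}^m}\ \mathcal{L}(x,y):=f(x)+\langle Kx,y\rangle-g^*(y)\tag{PD}$$ has a saddle point. Let $\Sigma_f$ be a symmetric positive semidefinite matrix with $\langle\xi_1-\xi_2,x_1-x_2\rangle\ge\langle x_1-x_2,\Sigma_f(x_1-x_2)\rangle$ for all $x_1,x_2\in\mathbb{R}^n$, $\xi_1\in\partial f(x_1)$, $\xi_2\in\partial f(x_2)$. For symmetric matrices $M_1\in\mathbb{R}^{n\times n}$, $M_2\in\mathbb{R}^{m\times m}$ write $\|z\|_{M}^2=\langle z,Mz\rangle$, and let $\{(x^k,y^k)\}_{k\ge0}$ be generated from an arbitrary $(x^0,y^0)$ by the preconditioned PDHG method $$x^{k+1}=\operatorname*{argmin}_{x}\ f(x)+\langle Kx,y^k\rangle+\tfrac12\|x-x^k\|_{M_1}^2,$$ $$y^{k+1}=\operatorname*{argmin}_{y}\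 g^*(y)-\langle K(2x^{k+1}-x^k),y\rangle+\tfrac12\|y-y^k\|_{M_2}^2 .$$ For $\rho_2\in\mathbb{R}$ consider the condition (with $\|\cdot\|$ the spectral norm) $$M_1+\rho_2\Sigma_f\succ0,\qquad M_2\succ0,\qquad \left\|M_2^{-1/2}K\,(M_1+\rho_2\Sigma_f)^{-1/2}\right\|^2<\tfrac43.\tag{C}$$ (a) If $\rho_2\le\tfrac12$ and (C) holds, then $\{(x^k,y^k)\}$ converges to a saddle point of (PD). (b) If $\rho_2>\tfrac12$, then under (C) the sequence need not converge. More precisely, for every $\rho_2>\tfrac12$, consider $\min_{x\in\mathbb{R}}\max_{y\in\mathbb{R}}\ \tfrac12x^2+xy$, that is, $n=m=1$, $f(x)=\tfrac12x^2$, $g$ the indicator function of $\{0\}$ (so $g^*=0$), $K=1$; it satisfies the assumptions above with $\Sigma_f=1$. There are $\tau,\sigma>0$ such that $M_1=1/\tau$, $M_2=1/\sigma$ satisfy (C); the method is the linear iteration $$\begin{pmatrix}x^{k+1}\\y^{k+1}\end{pmatrix}=\widetilde G\begin{pmatrix}x^{k}\\y^{k}\end{pmatrix},\qquad \widetilde G=\frac1{1+\tau}\begin{pmatrix}1&-\tau\\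 \sigma(1-\tau)&1+\tau-2\tau\sigma\end{pmatrix};$$ $\widetilde G$ has a real eigenvalue less than $-1$; and for some $(x^0,y^0)$ the generated sequence does not converge. -/

import Mathlib

open scoped Matrix MatrixOrder

namespace PrePDHG

noncomputable section

/-- The Euclidean space `ℝⁿ` with its standard inner product. -/
abbrev E (n : ℕ) : Type := EuclideanSpace ℝ (Fin n)

/-- The linear map `x ↦ A x` of a real matrix. -/
abbrev act {m n : ℕ} (A : Matrix (Fin m) (Fin n) ℝ) (x : E n) : E m :=
  Matrix.toEuclideanLin A x

/-- `‖z‖²_M = ⟨z, M z⟩` (a quadratic form; `M` may be indefinite). -/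
def normSq {n : ℕ} (M : Matrix (Fin n) (Fin n) ℝ) (z : E n) : ℝ :=
  inner ℝ z (act M z)

/-- The spectral norm of a matrix, i.e. its operator norm for the `ℓ₂` norms. -/
def specNorm {m n : ℕ} (A : Matrix (Fin m) (Fin n) ℝ) : ℝ :=
  ‖LinearMap.toContinuousLinearMap (Matrix.toEuclideanLin A)‖

/-- `M^{-1/2}`: the positive semidefinite square root of `M⁻¹` (used only for `M ≻ 0`). -/
def invSqrt {n : ℕ} (M : Matrix (Fin n) (Fin n) ℝ) : Matrix (Fin n) (Fin n) ℝ :=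
  CFC.sqrt M⁻¹

/-- A proper closed convex function `ℝⁿ → (-∞, +∞]`: never `-∞`, somewhere finite,
lower semicontinuous, with convex epigraph. -/
structure IsProperClosedConvex {n : ℕ} (f : E n → EReal) : Prop where
  ne_bot : ∀ x, f x ≠ ⊥
  exists_ne_top : ∃ x, f x ≠ ⊤
  lsc : LowerSemicontinuous f
  convex : Convex ℝ {p : E n × ℝ | f p.1 ≤ (p.2 : EReal)}

/-- The convex conjugate `g*(y) = sup_z {⟨z, y⟩ - g z}`. -/
def conj {m : ℕ} (g : E m → EReal) (y : E m) : EReal :=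
  ⨆ z : E m, (((inner ℝ z y : ℝ) : EReal) - g z)

/-- The subdifferential `∂f(x₀)`, empty outside the effective domain of `f`. -/
def subdiff {n : ℕ} (f : E n → EReal) (x₀ : E n) : Set (E n) :=
  {ξ | f x₀ ≠ ⊤ ∧ ∀ x, f x₀ + ((inner ℝ ξ (x - x₀) : ℝ) : EReal) ≤ f x}

/-- `S` is admissible as the matrix `Σ_f`: it is symmetric positive semidefinite and
`⟨ξ₁ - ξ₂, x₁ - x₂⟩ ≥ ‖x₁ - x₂‖²_S` for all `ξ₁ ∈ ∂f(x₁)`, `ξ₂ ∈ ∂f(x₂)`. -/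
structure IsSigma {n : ℕ} (f : E n → EReal) (S : Matrix (Fin n) (Fin n) ℝ) : Prop where
  posSemidef : S.PosSemidef
  monotone : ∀ x₁ x₂ : E n, ∀ ξ₁ ∈ subdiff f x₁, ∀ ξ₂ ∈ subdiff f x₂,
    normSq S (x₁ - x₂) ≤ inner ℝ (ξ₁ - ξ₂) (x₁ - x₂)

/-- `L(x, y) = f(x) + ⟨K x, y⟩ - g*(y)`. -/
def lagrangian {n m : ℕ} (f : E n → EReal) (g : E m → EReal)
    (K : Matrix (Fin m) (Fin n) ℝ) (x : E n) (y : E m) : EReal :=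
  f x + ((inner ℝ (act K x) y : ℝ) : EReal) - conj g y

/-- Saddle points of `min_x max_y L(x, y)`. They lie in `dom f × dom g*`, so that no expression
`∞ - ∞` occurs in the two inequalities. -/
structure IsSaddlePoint {n m : ℕ} (f : E n → EReal) (g : E m → EReal)
    (K : Matrix (Fin m) (Fin n) ℝ) (xs : E n) (ys : E m) : Prop where
  mem_dom : f xs ≠ ⊤
  mem_dom_conj : conj g ys ≠ ⊤
  max_right : ∀ y, lagrangian f g K xs y ≤ lagrangian f g K xs ys
  min_left : ∀ x, lagrangian f g K xs ys ≤ lagrangian f g K x ys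

/-- The standing assumptions on the problem `min_x max_y f(x) + ⟨K x, y⟩ - g*(y)` with a chosen
matrix `Σ_f = S`. -/
structure IsProblem {n m : ℕ} (f : E n → EReal) (g : E m → EReal)
    (K : Matrix (Fin m) (Fin n) ℝ) (S : Matrix (Fin n) (Fin n) ℝ) : Prop where
  f_convex : IsProperClosedConvex f
  g_convex : IsProperClosedConvex g
  sigma : IsSigma f S
  exists_saddle : ∃ xs ys, IsSaddlePoint f g K xs ys

/-- `(xᵏ, yᵏ)` is generated by the preconditioned PDHG method from `(x⁰, y⁰)`: each update is a
global minimizer of its subproblem. -/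
structure IsGenerated {n m : ℕ} (f : E n → EReal) (g : E m → EReal)
    (K : Matrix (Fin m) (Fin n) ℝ) (M₁ : Matrix (Fin n) (Fin n) ℝ)
    (M₂ : Matrix (Fin m) (Fin m) ℝ) (x : ℕ → E n) (y : ℕ → E m) : Prop where
  x_step : ∀ k, IsMinOn
    (fun z : E n => f z +
      ((inner ℝ (act K z) (y k) + 1 / 2 * normSq M₁ (z - x k) : ℝ) : EReal))
    Set.univ (x (k + 1))
  y_step : ∀ k, IsMinOn
    (fun w : E m => conj g w +
      ((-inner ℝ (act K ((2 : ℝ) • x (k + 1) - x k)) w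
        + 1 / 2 * normSq M₂ (w - y k) : ℝ) : EReal))
    Set.univ (y (k + 1))

/-- The parameter condition with constant `ρ` in front of `Σ_f = S`: `M₁, M₂` symmetric,
`M₁ + ρ S ≻ 0`, `M₂ ≻ 0` and `‖M₂^{-1/2} K (M₁ + ρ S)^{-1/2}‖² < 4/3`. -/
structure ParamCondition {n m : ℕ} (ρ : ℝ) (K : Matrix (Fin m) (Fin n) ℝ)
    (S M₁ : Matrix (Fin n) (Fin n) ℝ) (M₂ : Matrix (Fin m) (Fin m) ℝ) : Prop where
  symm₁ : M₁.IsSymm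
  symm₂ : M₂.IsSymm
  posDef₁ : (M₁ + ρ • S).PosDef
  posDef₂ : M₂.PosDef
  norm_lt : specNorm (invSqrt M₂ * K * invSqrt (M₁ + ρ • S)) ^ 2 < 4 / 3

/-- The one-dimensional function `x ↦ x² / 2`. -/
def exF (x : E 1) : EReal := ((1 / 2 * (x 0) ^ 2 : ℝ) : EReal)

open Classical in
/-- The indicator function of `{0} ⊆ ℝ`, whose conjugate is the zero function. -/
def exG (z : E 1) : EReal := if z = 0 then 0 else ⊤

/-- The matrix of the iteration for `min_x max_y x² / 2 + x y` with `M₁ = 1/τ`, `M₂ = 1/σ`. -/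
def exIter (τ σ : ℝ) : Matrix (Fin 2) (Fin 2) ℝ :=
  (1 / (1 + τ)) • !![1, -τ; σ * (1 - τ), 1 + τ - 2 * τ * σ]

end

end PrePDHG

/-! Optimality turns the method into two monotone inclusions; saddle points solve the same
inclusions without proximal terms. Put A = M₁ + S/2, N = M₂⁻¹, G = KᵀNK ≤ cA with c < 4/3, uₖ = xᵏ⁺¹
- xᵏ, and sₖ = K uₖ - M₂(yᵏ⁺¹ - yᵏ). Monotonicity against a solution (`energy_succ_le`) makes the
energy drop by ‖uₖ₊₁‖²_A - ‖uₖ₊₁‖²_G + ‖sₖ‖²_N, which need not be positive when c > 1. Adding the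
monotonicity of ∂f between consecutive steps (`increment_le`) and absorbing ⟨K uₖ₊₁, N sₖ⟩ by
Young's inequality leaves -2‖uₖ₊₁‖²_A + (5/4)‖uₖ₊₁‖²_G plus the cross term ⟨uₖ₊₁, (A - G)uₖ⟩. With P
= (2 - ε)A - (5/4)G, the bounds -P ≤ A - G ≤ P split that term into halves that telescope
(`cross_le`, `potential_succ_le`). The lower bound reads (9/4)G ≤ (3 - ε)A, possible for some ε > 0
because c < 4/3. So the potential decreases, uₖ and sₖ tend to 0, cluster points are solutions, and
the energy recentred at one of them forces convergence. For ρ > 1/2, taking τ = 1 and 2 < σ <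
(4/3)(1 + ρ) gives the eigenvalue 1 - σ < -1. -/

namespace PrePDHG

open Filter Topology

/-! ### Quadratic forms and one-step inequalities -/

section Abstract

variable {V W : Type*} [NormedAddCommGroup V] [InnerProductSpace ℝ V]
  [NormedAddCommGroup W] [InnerProductSpace ℝ W]

/-- A positive definite form on a finite-dimensional space dominates a multiple of the norm. -/
theorem exists_coercive [FiniteDimensional ℝ V] (A : V →ₗ[ℝ] V)
    (hA : ∀ z, z ≠ 0 → 0 < inner ℝ z (A z)) :
    ∃ a : ℝ, 0 < a ∧ ∀ z, a * ‖z‖ ^ 2 ≤ inner ℝ z (A z) := by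
  have hc : Continuous fun z : V => inner ℝ z (A z) :=
    continuous_id.inner A.continuous_of_finiteDimensional
  have key : ∃ a : ℝ, 0 < a ∧ ∀ z ∈ Metric.sphere (0 : V) 1, a ≤ inner ℝ z (A z) := by
    rcases (Metric.sphere (0 : V) 1).eq_empty_or_nonempty with h | h
    -- An empty sphere means the space is trivial, so any positive constant works.
    · exact ⟨1, one_pos, by simp [h]⟩
    · have : ProperSpace V := FiniteDimensional.proper ℝ V
      obtain ⟨w, hw, hmin⟩ := (isCompact_sphere (0 : V) 1).exists_isMinOn h hc.continuousOn
      refine ⟨_, hA w ?_, fun z hz => hmin hz⟩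
      rintro rfl
      simp at hw
  obtain ⟨a, ha, h⟩ := key
  refine ⟨a, ha, fun z => ?_⟩
  rcases eq_or_ne z 0 with rfl | hz
  · simp
  have hn : 0 < ‖z‖ := norm_pos_iff.2 hz
  have := h (‖z‖⁻¹ • z) (by simp [norm_smul, hn.ne'])
  rw [map_smul, real_inner_smul_left, real_inner_smul_right] at this
  calc a * ‖z‖ ^ 2 ≤ (‖z‖⁻¹ * (‖z‖⁻¹ * inner ℝ z (A z))) * ‖z‖ ^ 2 := by gcongr
    _ = inner ℝ z (A z) := by field_simp

theorem tendsto_zero_of_coercive {ι : Type*} {l : Filter ι} {A : V →ₗ[ℝ] V} {a : ℝ} (ha : 0 < a)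
    (hA : ∀ z, a * ‖z‖ ^ 2 ≤ inner ℝ z (A z)) {z : ι → V}
    (hz : Tendsto (fun i => inner ℝ (z i) (A (z i))) l (𝓝 0)) : Tendsto z l (𝓝 0) := by
  have h1 : Tendsto (fun i => ‖z i‖ ^ 2) l (𝓝 0) := by
    refine squeeze_zero (fun i => sq_nonneg _) (fun i => ?_) (by simpa using hz.const_mul a⁻¹)
    rw [inv_mul_eq_div, le_div_iff₀ ha, mul_comm]
    exact hA _
  rw [tendsto_zero_iff_norm_tendsto_zero]
  simpa [Real.sqrt_sq] using h1.sqrt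

theorem tendsto_inner_map [FiniteDimensional ℝ V] {ι : Type*} {l : Filter ι} (A : V →ₗ[ℝ] V)
    {z : ι → V} {z₀ : V} (hz : Tendsto z l (𝓝 z₀)) :
    Tendsto (fun i => inner ℝ (z i) (A (z i))) l (𝓝 (inner ℝ z₀ (A z₀))) :=
  hz.inner ((A.continuous_of_finiteDimensional.tendsto z₀).comp hz)

theorem inner_map_add_self {A : V →ₗ[ℝ] V} (hA : A.IsSymmetric) (a b : V) :
    inner ℝ (a + b) (A (a + b)) = inner ℝ a (A a) + 2 * inner ℝ a (A b) + inner ℝ b (A b) := by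
  have := hA b a
  rw [real_inner_comm] at this
  simp only [map_add, inner_add_left, inner_add_right]
  linarith

/-- The descent estimate for the distance to a solution. -/
theorem energy_step {M₁ S : V →ₗ[ℝ] V} {M₂ N : W →ₗ[ℝ] W} {K : V →ₗ[ℝ] W} {Kt : W →ₗ[ℝ] V}
    (hM₁ : M₁.IsSymmetric) (hS : S.IsSymmetric) (hM₂ : M₂.IsSymmetric)
    (hMN : ∀ w, M₂ (N w) = w)
    (hK : ∀ x y, inner ℝ (K x) y = inner ℝ x (Kt y))
    (hS0 : ∀ z, 0 ≤ inner ℝ z (S z))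
    {X u : V} {Y s : W}
    (h₁ : inner ℝ (X + u) (S (X + u)) ≤ inner ℝ (-(Kt Y) - M₁ u) (X + u))
    (h₂ : 0 ≤ inner ℝ (K X + s) Y) :
    inner ℝ (X + u) ((M₁ + S) (X + u)) + inner ℝ (Y + N (K u)) (M₂ (Y + N (K u)))
      ≤ inner ℝ X ((M₁ + S) X) + inner ℝ (Y + N s) (M₂ (Y + N s))
        - inner ℝ u ((M₁ + (1 / 2 : ℝ) • S) u) + inner ℝ (K u) (N (K u)) - inner ℝ s (N s) := by
  -- This is ‖X‖²_S + ‖X + u‖²_S ≥ ½‖u‖²_S. It trades strong monotonicity for the weight M₁ + S in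
  -- the energy and the ½S in the decrease.
  have h3 := hS0 ((2 : ℝ) • X + u)
  rw [inner_map_add_self hS] at h3 h₁
  have e1 := inner_map_add_self (hM₁.add hS) X u
  have e2 := inner_map_add_self hM₂ Y (N (K u))
  have e3 := inner_map_add_self hM₂ Y (N s)
  rw [hMN] at e2 e3
  rw [e1, e2, e3]
  have k1 := hK X Y
  have k2 := hK u Y
  have m1 := hM₁ u X
  simp only [LinearMap.add_apply, LinearMap.smul_apply, map_smul, inner_add_left, inner_add_right,
    inner_sub_left, inner_neg_left, real_inner_smul_left, real_inner_smul_right] at *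
  rw [real_inner_comm X (Kt Y), real_inner_comm u (Kt Y), real_inner_comm u (M₁ u)] at h₁
  rw [real_inner_comm (K u) Y, real_inner_comm (K u) (N (K u)), real_inner_comm s Y,
    real_inner_comm s (N s)]
  have m2 : inner ℝ u (M₁ X) = inner ℝ X (M₁ u) := by rw [← hM₁, real_inner_comm]
  linarith

/-- The estimate for the monotonicity inequality of two consecutive steps. -/
theorem increment_step {M₁ S : V →ₗ[ℝ] V} {N : W →ₗ[ℝ] W} {K : V →ₗ[ℝ] W} {Kt : W →ₗ[ℝ] V}
    (hS : S.IsSymmetric) (hK : ∀ x y, inner ℝ (K x) y = inner ℝ x (Kt y))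
    (hS0 : ∀ z, 0 ≤ inner ℝ z (S z)) {u u' : V} {s v : W} (hv : v = N (K u') - N s)
    (h : inner ℝ u (S u) ≤ inner ℝ (-(Kt v) - M₁ (u - u')) u) :
    0 ≤ -inner ℝ u ((M₁ + (1 / 2 : ℝ) • S) u) + inner ℝ u ((M₁ + (1 / 2 : ℝ) • S) u')
      - inner ℝ (K u) (N (K u')) + inner ℝ (K u) (N s)
      + 1 / 4 * inner ℝ u' (S u') - 1 / 4 * inner ℝ u (S u) := by
  -- Bounds -½⟨u, S u'⟩, the error of replacing M₁ by M₁ + S/2 in the cross term; what remains in S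
  -- telescopes.
  have h3 := hS0 (u + u')
  rw [inner_map_add_self hS] at h3
  have k1 := hK u v
  rw [real_inner_comm u (-(Kt v) - M₁ (u - u')), inner_sub_right, inner_neg_right, ← k1] at h
  subst hv
  simp only [LinearMap.add_apply, LinearMap.smul_apply, map_sub, inner_add_right,
    inner_sub_right, real_inner_smul_right] at *
  linarith

/-- Cauchy's inequality for a form `B` with `-P ≤ B ≤ P`. -/
theorem inner_le_of_dominated {B P : V →ₗ[ℝ] V} (hB : B.IsSymmetric) (hP : P.IsSymmetric)
    (h₁ : ∀ z, inner ℝ z (B z) ≤ inner ℝ z (P z)) (h₂ : ∀ z, -inner ℝ z (B z) ≤ inner ℝ z (P z))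
    (a b : V) : inner ℝ a (B b) ≤ 1 / 2 * inner ℝ a (P a) + 1 / 2 * inner ℝ b (P b) := by
  -- Polarization: 4⟨a, B b⟩ is the form of B at a + b minus that at a - b.
  have e1 := h₁ (a + b)
  have e2 := h₂ (a + -b)
  rw [inner_map_add_self hB, inner_map_add_self hP] at e1 e2
  simp only [map_neg, inner_neg_right, inner_neg_left] at e2
  linarith

/-- The parameters, the iteration and the two monotone operators, in coordinate-free form. -/
structure Iteration (Tf : V → Set V) (Tg : W → Set W) (M₁ S : V →ₗ[ℝ] V) (M₂ N : W →ₗ[ℝ] W)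
    (K : V →ₗ[ℝ] W) (Kt : W →ₗ[ℝ] V) (c : ℝ) (x : ℕ → V) (y : ℕ → W) : Prop where
  symm_M₁ : M₁.IsSymmetric
  symm_S : S.IsSymmetric
  symm_M₂ : M₂.IsSymmetric
  symm_N : N.IsSymmetric
  M₂_N : ∀ w, M₂ (N w) = w
  N_M₂ : ∀ w, N (M₂ w) = w
  adjoint : ∀ x y, inner ℝ (K x) y = inner ℝ x (Kt y)
  nonneg_S : ∀ z, 0 ≤ inner ℝ z (S z)
  pos₁ : ∀ z, z ≠ 0 → 0 < inner ℝ z ((M₁ + (1 / 2 : ℝ) • S) z)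
  pos₂ : ∀ w, w ≠ 0 → 0 < inner ℝ w (M₂ w)
  lt : c < 4 / 3
  bound : ∀ z, inner ℝ (K z) (N (K z)) ≤ c * inner ℝ z ((M₁ + (1 / 2 : ℝ) • S) z)
  mono_f : ∀ x₁ x₂, ∀ ξ₁ ∈ Tf x₁, ∀ ξ₂ ∈ Tf x₂,
    inner ℝ (x₁ - x₂) (S (x₁ - x₂)) ≤ inner ℝ (ξ₁ - ξ₂) (x₁ - x₂)
  mono_g : ∀ y₁ y₂, ∀ η₁ ∈ Tg y₁, ∀ η₂ ∈ Tg y₂, 0 ≤ inner ℝ (η₁ - η₂) (y₁ - y₂)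
  step_x : ∀ k, -(Kt (y k)) - M₁ (x (k + 1) - x k) ∈ Tf (x (k + 1))
  step_y : ∀ k, K ((2 : ℝ) • x (k + 1) - x k) - M₂ (y (k + 1) - y k) ∈ Tg (y (k + 1))

/-! ### Lyapunov analysis of the iteration -/

namespace Iteration

variable {Tf : V → Set V} {Tg : W → Set W} {M₁ S : V →ₗ[ℝ] V} {M₂ N : W →ₗ[ℝ] W}
    {K : V →ₗ[ℝ] W} {Kt : W →ₗ[ℝ] V} {c : ℝ} {x : ℕ → V} {y : ℕ → W}

/-- The defect `K (xᵏ⁺¹ - xᵏ) - M₂ (yᵏ⁺¹ - yᵏ)`. -/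
def defect (M₂ : W →ₗ[ℝ] W) (K : V →ₗ[ℝ] W) (x : ℕ → V) (y : ℕ → W) (k : ℕ) : W :=
  K (x (k + 1) - x k) - M₂ (y (k + 1) - y k)

/-- The weighted squared distance to `(xs, ys)`. -/
def energy (M₁ S : V →ₗ[ℝ] V) (M₂ N : W →ₗ[ℝ] W) (K : V →ₗ[ℝ] W) (x : ℕ → V) (y : ℕ → W)
    (xs : V) (ys : W) (k : ℕ) : ℝ :=
  inner ℝ (x (k + 1) - xs) ((M₁ + S) (x (k + 1) - xs)) +
    inner ℝ (y (k + 1) - ys + N (defect M₂ K x y k))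
      (M₂ (y (k + 1) - ys + N (defect M₂ K x y k)))

/-- The form `(2 - ε) A - (5 / 4) Kᵀ N K` with `A = M₁ + S / 2`. -/
noncomputable def weight (M₁ S : V →ₗ[ℝ] V) (N : W →ₗ[ℝ] W) (K : V →ₗ[ℝ] W) (Kt : W →ₗ[ℝ] V) (ε : ℝ) :
    V →ₗ[ℝ] V :=
  (2 - ε) • (M₁ + (1 / 2 : ℝ) • S) - (5 / 4 : ℝ) • (Kt ∘ₗ N ∘ₗ K)

/-- The Lyapunov function of the iteration. -/
noncomputable def potential (M₁ S : V →ₗ[ℝ] V) (M₂ N : W →ₗ[ℝ] W) (K : V →ₗ[ℝ] W)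
    (Kt : W →ₗ[ℝ] V) (ε : ℝ) (x : ℕ → V) (y : ℕ → W) (xs : V) (ys : W) (k : ℕ) : ℝ :=
  energy M₁ S M₂ N K x y xs ys k
    + 1 / 2 * inner ℝ (x (k + 1) - x k) (weight M₁ S N K Kt ε (x (k + 1) - x k))
    + 1 / 4 * inner ℝ (x (k + 1) - x k) (S (x (k + 1) - x k))

theorem tendsto_potential_sub_energy [FiniteDimensional ℝ V]
    (hu : Tendsto (fun k => x (k + 1) - x k) atTop (𝓝 0)) (ε : ℝ) (xs : V) (ys : W) :
    Tendsto (fun k => potential M₁ S M₂ N K Kt ε x y xs ys k - energy M₁ S M₂ N K x y xs ys k)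
      atTop (𝓝 0) := by
  have := ((tendsto_inner_map (weight M₁ S N K Kt ε) hu).const_mul (1 / 2)).add
    ((tendsto_inner_map S hu).const_mul (1 / 4))
  simp only [inner_zero_left, mul_zero, add_zero] at this
  refine this.congr fun k => ?_
  unfold potential
  ring

variable (h : Iteration Tf Tg M₁ S M₂ N K Kt c x y)
include h

/-- The inclusions at xᵏ⁺² and at yᵏ⁺¹ are paired: both involve yᵏ⁺¹, so its couplings cancel
against the M₂ part of the energy. -/
theorem energy_succ_le {xs : V} {ys : W} (hxs : -(Kt ys) ∈ Tf xs) (hys : K xs ∈ Tg ys) (k : ℕ) :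
    energy M₁ S M₂ N K x y xs ys (k + 1) ≤ energy M₁ S M₂ N K x y xs ys k
      - inner ℝ (x (k + 2) - x (k + 1)) ((M₁ + (1 / 2 : ℝ) • S) (x (k + 2) - x (k + 1)))
      + inner ℝ (K (x (k + 2) - x (k + 1))) (N (K (x (k + 2) - x (k + 1))))
      - inner ℝ (defect M₂ K x y k) (N (defect M₂ K x y k)) := by
  have h₁ := h.mono_f _ _ _ (h.step_x (k + 1)) _ hxs
  have h₂ := h.mono_g _ _ _ (h.step_y k) _ hys
  have ex : x (k + 2) - xs = (x (k + 1) - xs) + (x (k + 2) - x (k + 1)) := by abel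
  have := energy_step h.symm_M₁ h.symm_S h.symm_M₂ h.M₂_N h.adjoint h.nonneg_S
    (X := x (k + 1) - xs) (u := x (k + 2) - x (k + 1)) (Y := y (k + 1) - ys)
    (s := defect M₂ K x y k) ?_ ?_
  · unfold energy
    -- The defect is chosen so that yᵏ⁺² + N sₖ₊₁ = yᵏ⁺¹ + N K uₖ₊₁, which no longer involves yᵏ⁺².
    have ey : y (k + 1 + 1) - ys + N (defect M₂ K x y (k + 1)) =
        y (k + 1) - ys + N (K (x (k + 2) - x (k + 1))) := by
      rw [defect, map_sub, h.N_M₂]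
      abel
    rw [ey, show k + 1 + 1 = k + 2 from rfl, ex]
    exact this
  · rw [← ex]
    convert h₁ using 2
    rw [map_sub]
    abel
  · convert h₂ using 2
    rw [defect, two_smul]
    simp only [map_sub, map_add]
    abel

theorem increment_le (k : ℕ) :
    0 ≤ -inner ℝ (x (k + 2) - x (k + 1)) ((M₁ + (1 / 2 : ℝ) • S) (x (k + 2) - x (k + 1)))
      + inner ℝ (x (k + 2) - x (k + 1)) ((M₁ + (1 / 2 : ℝ) • S) (x (k + 1) - x k))
      - inner ℝ (K (x (k + 2) - x (k + 1))) (N (K (x (k + 1) - x k)))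
      + inner ℝ (K (x (k + 2) - x (k + 1))) (N (defect M₂ K x y k))
      + 1 / 4 * inner ℝ (x (k + 1) - x k) (S (x (k + 1) - x k))
      - 1 / 4 * inner ℝ (x (k + 2) - x (k + 1)) (S (x (k + 2) - x (k + 1))) := by
  have h₁ := h.mono_f _ _ _ (h.step_x (k + 1)) _ (h.step_x k)
  refine increment_step h.symm_S h.adjoint h.nonneg_S (v := y (k + 1) - y k) ?_ ?_
  · rw [defect, map_sub N, h.N_M₂]
    abel
  · convert h₁ using 2
    simp only [map_sub]
    abel

theorem nonneg₁ (z : V) : 0 ≤ inner ℝ z ((M₁ + (1 / 2 : ℝ) • S) z) := by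
  rcases eq_or_ne z 0 with rfl | hz
  · simp
  · exact (h.pos₁ z hz).le

theorem nonneg₂ (w : W) : 0 ≤ inner ℝ w (M₂ w) := by
  rcases eq_or_ne w 0 with rfl | hw
  · simp
  · exact (h.pos₂ w hw).le

theorem nonneg_N (w : W) : 0 ≤ inner ℝ w (N w) := by
  have := h.nonneg₂ (N w)
  rwa [h.M₂_N, real_inner_comm] at this

theorem inner_gram (a b : V) : inner ℝ a ((Kt ∘ₗ N ∘ₗ K) b) = inner ℝ (K a) (N (K b)) := by
  rw [h.adjoint]
  rfl

theorem symm_sum : (M₁ + (1 / 2 : ℝ) • S).IsSymmetric := by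
  intro a b
  have h1 := h.symm_M₁ a b
  have h2 := h.symm_S a b
  simp only [LinearMap.add_apply, LinearMap.smul_apply, inner_add_left, inner_add_right,
    real_inner_smul_left, real_inner_smul_right, h1, h2]

theorem symm_gram : (Kt ∘ₗ N ∘ₗ K).IsSymmetric := by
  intro a b
  rw [real_inner_comm, h.inner_gram, h.inner_gram, ← h.symm_N, real_inner_comm]

theorem inner_weight (ε : ℝ) (z : V) : inner ℝ z (weight M₁ S N K Kt ε z) =
    (2 - ε) * inner ℝ z ((M₁ + (1 / 2 : ℝ) • S) z) - 5 / 4 * inner ℝ (K z) (N (K z)) := by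
  rw [← h.inner_gram, weight, LinearMap.sub_apply, LinearMap.smul_apply, LinearMap.smul_apply,
    inner_sub_right, real_inner_smul_right, real_inner_smul_right]

theorem symm_weight (ε : ℝ) : (weight M₁ S N K Kt ε).IsSymmetric := by
  intro a b
  have h1 := h.symm_sum a b
  have h2 := h.symm_gram a b
  simp only [weight, LinearMap.sub_apply, LinearMap.smul_apply (_ : ℝ) (_ : V →ₗ[ℝ] V) _,
    inner_sub_left, inner_sub_right, real_inner_smul_left, real_inner_smul_right, h1, h2]

/-- The form A - G lies between plus and minus the weight: the upper side is G/4 ≤ (1 - ε)A, ensured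
by ε ≤ 2/3; the lower is (9/4)G ≤ (3 - ε)A, ensured by the second bound on ε. -/
theorem cross_le {ε : ℝ} (h₁ : ε ≤ 2 / 3) (h₂ : ε ≤ 3 - 9 / 4 * c) (a b : V) :
    inner ℝ a ((M₁ + (1 / 2 : ℝ) • S) b) - inner ℝ (K a) (N (K b)) ≤
      1 / 2 * inner ℝ a (weight M₁ S N K Kt ε a) + 1 / 2 * inner ℝ b (weight M₁ S N K Kt ε b) := by
  rw [← h.inner_gram, ← inner_sub_right, ← LinearMap.sub_apply]
  have hc := h.lt
  refine inner_le_of_dominated (h.symm_sum.sub h.symm_gram) (h.symm_weight ε)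
    (fun z => ?_) (fun z => ?_) a b <;>
  · rw [h.inner_weight, LinearMap.sub_apply, inner_sub_right, h.inner_gram]
    have hb := h.bound z
    have hz := h.nonneg₁ z
    nlinarith [mul_nonneg (sub_nonneg.2 h₁) hz, mul_nonneg (sub_nonneg.2 h₂) hz,
      mul_nonneg (sub_nonneg.2 hc.le) hz]

theorem weight_nonneg {ε : ℝ} (h₁ : ε ≤ 2 / 3) (h₂ : ε ≤ 3 - 9 / 4 * c) (z : V) :
    0 ≤ inner ℝ z (weight M₁ S N K Kt ε z) := by
  have e1 := h.cross_le h₁ h₂ z z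
  have e2 := h.cross_le h₁ h₂ z (-z)
  simp only [map_neg, inner_neg_right, inner_neg_left] at e2
  linarith

/-- The sum of the energy, increment and cross estimates; the total coefficient -2A + (5/4)G equals
minus the weight minus εA. -/
theorem potential_succ_le {ε : ℝ} (h₁ : ε ≤ 2 / 3) (h₂ : ε ≤ 3 - 9 / 4 * c) {xs : V} {ys : W}
    (hxs : -(Kt ys) ∈ Tf xs) (hys : K xs ∈ Tg ys) (k : ℕ) :
    potential M₁ S M₂ N K Kt ε x y xs ys (k + 1) ≤ potential M₁ S M₂ N K Kt ε x y xs ys k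
      - ε * inner ℝ (x (k + 2) - x (k + 1)) ((M₁ + (1 / 2 : ℝ) • S) (x (k + 2) - x (k + 1))) := by
  have e1 := h.energy_succ_le hxs hys k
  have e2 := h.increment_le k
  have e3 := h.cross_le h₁ h₂ (x (k + 2) - x (k + 1)) (x (k + 1) - x k)
  have e4 := h.inner_weight ε (x (k + 2) - x (k + 1))
  -- Young: ⟨K u, N s⟩ - ‖s‖²_N ≤ ¼‖K u‖²_N, the source of 5/4 = 1 + 1/4.
  have e5 := h.nonneg_N (defect M₂ K x y k + -((1 / 2 : ℝ) • K (x (k + 2) - x (k + 1))))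
  have e6 : inner ℝ (defect M₂ K x y k) (N (K (x (k + 2) - x (k + 1)))) =
      inner ℝ (K (x (k + 2) - x (k + 1))) (N (defect M₂ K x y k)) := by
    rw [← h.symm_N, real_inner_comm]
  rw [inner_map_add_self h.symm_N] at e5
  simp only [map_neg, map_smul, inner_neg_left, inner_neg_right, real_inner_smul_left,
    real_inner_smul_right] at e5
  unfold potential
  rw [show k + 1 + 1 = k + 2 from rfl]
  linarith

/-! ### Vanishing increments and convergence -/

theorem nonneg_base (z : V) : inner ℝ z ((M₁ + (1 / 2 : ℝ) • S) z) ≤ inner ℝ z ((M₁ + S) z) := by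
  have := h.nonneg_S z
  simp only [LinearMap.add_apply, LinearMap.smul_apply, inner_add_right, real_inner_smul_right]
  linarith

theorem base_nonneg (z : V) : 0 ≤ inner ℝ z ((M₁ + S) z) :=
  (h.nonneg₁ z).trans (h.nonneg_base z)

theorem energy_nonneg (xs : V) (ys : W) (k : ℕ) : 0 ≤ energy M₁ S M₂ N K x y xs ys k :=
  add_nonneg (h.base_nonneg _) (h.nonneg₂ _)

theorem energy_le_potential {ε : ℝ} (h₁ : ε ≤ 2 / 3) (h₂ : ε ≤ 3 - 9 / 4 * c) (xs : V) (ys : W)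
    (k : ℕ) : energy M₁ S M₂ N K x y xs ys k ≤ potential M₁ S M₂ N K Kt ε x y xs ys k := by
  have := h.weight_nonneg h₁ h₂ (x (k + 1) - x k)
  have := h.nonneg_S (x (k + 1) - x k)
  unfold potential
  linarith

theorem exists_potential_limit {ε : ℝ} (h₀ : 0 < ε) (h₁ : ε ≤ 2 / 3) (h₂ : ε ≤ 3 - 9 / 4 * c)
    {xs : V} {ys : W} (hxs : -(Kt ys) ∈ Tf xs) (hys : K xs ∈ Tg ys) :
    Antitone (potential M₁ S M₂ N K Kt ε x y xs ys) ∧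
      ∃ l, Tendsto (potential M₁ S M₂ N K Kt ε x y xs ys) atTop (𝓝 l) := by
  have hanti : Antitone (potential M₁ S M₂ N K Kt ε x y xs ys) := by
    refine antitone_nat_of_succ_le fun k => (h.potential_succ_le h₁ h₂ hxs hys k).trans ?_
    have := mul_nonneg h₀.le (h.nonneg₁ (x (k + 2) - x (k + 1)))
    linarith
  refine ⟨hanti, _, tendsto_atTop_ciInf hanti ⟨0, ?_⟩⟩
  rintro _ ⟨k, rfl⟩
  exact (h.energy_nonneg xs ys k).trans (h.energy_le_potential h₁ h₂ xs ys k)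

theorem tendsto_x_sub [FiniteDimensional ℝ V] {ε : ℝ} (h₀ : 0 < ε) (h₁ : ε ≤ 2 / 3)
    (h₂ : ε ≤ 3 - 9 / 4 * c) {xs : V} {ys : W} (hxs : -(Kt ys) ∈ Tf xs) (hys : K xs ∈ Tg ys) :
    Tendsto (fun k => x (k + 1) - x k) atTop (𝓝 0) := by
  obtain ⟨-, l, hl⟩ := h.exists_potential_limit h₀ h₁ h₂ hxs hys
  obtain ⟨a, ha, hA⟩ := exists_coercive _ h.pos₁
  -- The decrease from k to k + 1 controls the increment with index k + 1.
  rw [← tendsto_add_atTop_iff_nat 1]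
  refine tendsto_zero_of_coercive ha hA ?_
  have hd : Tendsto (fun k => ε⁻¹ * (potential M₁ S M₂ N K Kt ε x y xs ys k
      - potential M₁ S M₂ N K Kt ε x y xs ys (k + 1))) atTop (𝓝 0) := by
    simpa using (hl.sub ((tendsto_add_atTop_iff_nat 1).2 hl)).const_mul ε⁻¹
  refine squeeze_zero (fun k => h.nonneg₁ _) (fun k => ?_) hd
  rw [inv_mul_eq_div, le_div_iff₀ h₀, mul_comm]
  have := h.potential_succ_le h₁ h₂ hxs hys k
  rw [show k + 1 + 1 = k + 2 from rfl]
  linarith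

/-- The potential and the energy share a limit once the increments vanish; the energy inequality
then bounds ‖sₖ‖²_N by Eₖ - Eₖ₊₁ + ‖K uₖ₊₁‖²_N. -/
theorem tendsto_defect [FiniteDimensional ℝ V] [FiniteDimensional ℝ W]
    {ε : ℝ} (h₀ : 0 < ε) (h₁ : ε ≤ 2 / 3)
    (h₂ : ε ≤ 3 - 9 / 4 * c) {xs : V} {ys : W} (hxs : -(Kt ys) ∈ Tf xs) (hys : K xs ∈ Tg ys) :
    Tendsto (defect M₂ K x y) atTop (𝓝 0) := by
  have hu := h.tendsto_x_sub h₀ h₁ h₂ hxs hys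
  obtain ⟨-, l, hl⟩ := h.exists_potential_limit h₀ h₁ h₂ hxs hys
  have hE : Tendsto (energy M₁ S M₂ N K x y xs ys) atTop (𝓝 l) := by
    simpa using hl.sub (tendsto_potential_sub_energy (M₁ := M₁) (S := S) (M₂ := M₂) (N := N)
      (K := K) (Kt := Kt) (y := y) hu ε xs ys)
  obtain ⟨b, hb, hN⟩ := exists_coercive N fun w hw => by
    have := h.pos₂ (N w) fun h0 => hw (by rw [← h.M₂_N w, h0, map_zero])
    rwa [h.M₂_N, real_inner_comm] at this
  refine tendsto_zero_of_coercive hb hN ?_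
  have hu' := (tendsto_add_atTop_iff_nat 1).2 (tendsto_inner_map (Kt ∘ₗ N ∘ₗ K) hu)
  have hlim := (hE.sub ((tendsto_add_atTop_iff_nat 1).2 hE)).add hu'
  rw [sub_self, inner_zero_left, add_zero] at hlim
  refine squeeze_zero (fun k => h.nonneg_N _) (fun k => ?_) hlim
  have e := h.energy_succ_le hxs hys k
  have e' := h.nonneg₁ (x (k + 2) - x (k + 1))
  rw [h.inner_gram, show k + 1 + 1 = k + 2 from rfl]
  linarith

/-- The iterates converge to a solution of the inclusions `-Kᵀ y ∈ Tf x`, `K x ∈ Tg y`. -/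
theorem exists_tendsto [FiniteDimensional ℝ V] [FiniteDimensional ℝ W]
    (hTf : ∀ (p ξ : ℕ → V) (p₀ ξ₀ : V), (∀ k, ξ k ∈ Tf (p k)) → Tendsto p atTop (𝓝 p₀) →
      Tendsto ξ atTop (𝓝 ξ₀) → ξ₀ ∈ Tf p₀)
    (hTg : ∀ (p ξ : ℕ → W) (p₀ ξ₀ : W), (∀ k, ξ k ∈ Tg (p k)) → Tendsto p atTop (𝓝 p₀) →
      Tendsto ξ atTop (𝓝 ξ₀) → ξ₀ ∈ Tg p₀)
    (hsol : ∃ xs ys, -(Kt ys) ∈ Tf xs ∧ K xs ∈ Tg ys) :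
    ∃ xs ys, (-(Kt ys) ∈ Tf xs ∧ K xs ∈ Tg ys) ∧ Tendsto x atTop (𝓝 xs) ∧
      Tendsto y atTop (𝓝 ys) := by
  have := FiniteDimensional.proper ℝ V
  have := FiniteDimensional.proper ℝ W
  obtain ⟨ε, h₀, h₁, h₂⟩ : ∃ ε : ℝ, 0 < ε ∧ ε ≤ 2 / 3 ∧ ε ≤ 3 - 9 / 4 * c :=
    ⟨min (2 / 3) (3 - 9 / 4 * c), lt_min (by norm_num) (by linarith [h.lt]),
      min_le_left _ _, min_le_right _ _⟩
  obtain ⟨xs, ys, hxs, hys⟩ := hsol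
  have hu := h.tendsto_x_sub h₀ h₁ h₂ hxs hys
  have hd := h.tendsto_defect h₀ h₁ h₂ hxs hys
  obtain ⟨a, ha, hA⟩ := exists_coercive (M₁ + S) fun z hz =>
    (h.pos₁ z hz).trans_le (h.nonneg_base z)
  obtain ⟨b, hb, hM⟩ := exists_coercive M₂ h.pos₂
  have cK := K.continuous_of_finiteDimensional
  have cKt := Kt.continuous_of_finiteDimensional
  have cN := N.continuous_of_finiteDimensional
  have cM₁ := M₁.continuous_of_finiteDimensional
  have cM₂ := M₂.continuous_of_finiteDimensional
  have hNd : Tendsto (fun k => N (defect M₂ K x y k)) atTop (𝓝 0) := by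
    simpa [Function.comp_def] using (cN.tendsto 0).comp hd
  have hv : Tendsto (fun k => y (k + 1) - y k) atTop (𝓝 0) := by
    have := ((cN.tendsto _).comp ((cK.tendsto _).comp hu)).sub hNd
    simp only [map_zero, sub_zero] at this
    refine this.congr fun k => ?_
    simp only [Function.comp_apply, defect, map_sub N (K _) (M₂ _), h.N_M₂]
    abel
  obtain ⟨R, hR⟩ : ∃ R, ∀ k, potential M₁ S M₂ N K Kt ε x y xs ys k ≤ R :=
    ⟨_, fun k => (h.exists_potential_limit h₀ h₁ h₂ hxs hys).1 (Nat.zero_le k)⟩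
  have hER : ∀ k, energy M₁ S M₂ N K x y xs ys k ≤ R := fun k =>
    (h.energy_le_potential h₁ h₂ xs ys k).trans (hR k)
  have hbx : ∀ k, x (k + 1) - xs ∈ Metric.closedBall (0 : V) √(R / a) := by
    intro k
    rw [mem_closedBall_zero_iff]
    refine Real.le_sqrt_of_sq_le ?_
    rw [le_div_iff₀ ha, mul_comm]
    exact (hA _).trans ((le_add_of_nonneg_right (h.nonneg₂ _)).trans (hER k))
  have hby : ∀ k, y (k + 1) - ys + N (defect M₂ K x y k) ∈
      Metric.closedBall (0 : W) √(R / b) := by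
    intro k
    rw [mem_closedBall_zero_iff]
    refine Real.le_sqrt_of_sq_le ?_
    rw [le_div_iff₀ hb, mul_comm]
    exact (hM _).trans ((le_add_of_nonneg_left (h.base_nonneg _)).trans (hER k))
  -- The energy bounds y only after the shift by N sₖ; since that shift vanishes, it does not affect
  -- the limit.
  obtain ⟨⟨X, Y⟩, -, φ, hφ, hlim⟩ := tendsto_subseq_of_bounded
    (Metric.isBounded_closedBall.prod Metric.isBounded_closedBall)
    (fun k => Set.mk_mem_prod (hbx k) (hby k))
  have hφ' := hφ.tendsto_atTop
  have hX : Tendsto (fun k => x (φ k + 1)) atTop (𝓝 (X + xs)) := by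
    simpa [Function.comp_def] using
      ((continuous_fst.tendsto _).comp hlim).add_const xs
  have hY : Tendsto (fun k => y (φ k + 1)) atTop (𝓝 (Y + ys)) := by
    have := (((continuous_snd.tendsto _).comp hlim).sub (hNd.comp hφ')).add_const ys
    rw [sub_zero] at this
    refine this.congr fun k => ?_
    simp only [Function.comp_apply]
    abel
  have hX' : Tendsto (fun k => x (φ k)) atTop (𝓝 (X + xs)) := by
    simpa [Function.comp_def] using hX.sub (hu.comp hφ')
  have hY' : Tendsto (fun k => y (φ k)) atTop (𝓝 (Y + ys)) := by
    simpa [Function.comp_def] using hY.sub (hv.comp hφ')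
  generalize X + xs = X₀ at hX hX'
  generalize Y + ys = Y₀ at hY hY'
  have hX₀ : -(Kt Y₀) ∈ Tf X₀ := by
    refine hTf _ _ _ _ (fun k => h.step_x (φ k)) hX ?_
    have := ((cKt.tendsto _).comp hY').neg.sub ((cM₁.tendsto _).comp (hu.comp hφ'))
    simpa [Function.comp_def] using this
  have hY₀ : K X₀ ∈ Tg Y₀ := by
    refine hTg _ _ _ _ (fun k => h.step_y (φ k)) hY ?_
    have := ((cK.tendsto _).comp ((hX.const_smul (2 : ℝ)).sub hX')).sub
      ((cM₂.tendsto _).comp (hv.comp hφ'))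
    simpa [Function.comp_def, two_smul] using this
  -- The cluster point is itself a solution, so the energy centred there has a limit; along φ that
  -- limit is 0.
  obtain ⟨-, l, hl⟩ := h.exists_potential_limit h₀ h₁ h₂ hX₀ hY₀
  have hE : Tendsto (energy M₁ S M₂ N K x y X₀ Y₀) atTop (𝓝 l) := by
    simpa using hl.sub (tendsto_potential_sub_energy (M₁ := M₁) (S := S) (M₂ := M₂) (N := N)
      (K := K) (Kt := Kt) (y := y) hu ε X₀ Y₀)
  have hE0 : Tendsto (energy M₁ S M₂ N K x y X₀ Y₀ ∘ φ) atTop (𝓝 0) := by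
    have := (tendsto_inner_map (M₁ + S) (hX.sub_const X₀)).add
      (tendsto_inner_map M₂ ((hY.sub_const Y₀).add (hNd.comp hφ')))
    simp only [sub_self, add_zero, inner_zero_left] at this
    exact this
  rw [tendsto_nhds_unique (hE.comp hφ') hE0] at hE
  refine ⟨X₀, Y₀, ⟨hX₀, hY₀⟩, (tendsto_add_atTop_iff_nat 1).1 ?_,
    (tendsto_add_atTop_iff_nat 1).1 ?_⟩
  · rw [← tendsto_sub_nhds_zero_iff]
    exact tendsto_zero_of_coercive ha hA (squeeze_zero (fun k => h.base_nonneg _)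
      (fun k => le_add_of_nonneg_right (h.nonneg₂ _)) hE)
  · have := tendsto_zero_of_coercive hb hM (squeeze_zero (fun k => h.nonneg₂ _)
      (fun k => le_add_of_nonneg_left (h.base_nonneg _)) hE)
    rw [← tendsto_sub_nhds_zero_iff]
    simpa using this.sub hNd

end Iteration

end Abstract
-- Subdifferentials, conjugates and saddle points
section Subdifferential

variable {n m : ℕ}

theorem subdiff_mono {h : E n → EReal} (hbot : ∀ x, h x ≠ ⊥) {x₁ x₂ ξ₁ ξ₂ : E n}
    (h₁ : ξ₁ ∈ subdiff h x₁) (h₂ : ξ₂ ∈ subdiff h x₂) : 0 ≤ inner ℝ (ξ₁ - ξ₂) (x₁ - x₂) := by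
  have e1 := h₁.2 x₂
  have e2 := h₂.2 x₁
  rw [← EReal.coe_toReal h₁.1 (hbot _), ← EReal.coe_toReal h₂.1 (hbot _)] at e1 e2
  norm_cast at e1 e2
  rw [inner_sub_right] at e1 e2 ⊢
  rw [inner_sub_left, inner_sub_left]
  linarith

theorem subdiff_closed {h : E n → EReal} (hbot : ∀ x, h x ≠ ⊥) (htop : ∃ x, h x ≠ ⊤)
    (hlsc : LowerSemicontinuous h) (p ξ : ℕ → E n) (p₀ ξ₀ : E n)
    (hmem : ∀ k, ξ k ∈ subdiff h (p k)) (hp : Tendsto p atTop (𝓝 p₀))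
    (hξ : Tendsto ξ atTop (𝓝 ξ₀)) : ξ₀ ∈ subdiff h p₀ := by
  -- If this failed, a real r strictly between the sides would, by lower semicontinuity, contradict
  -- the subgradient inequality for large k. At a point of the domain it also gives h p₀ < ⊤.
  have key : ∀ z, h z ≠ ⊤ → h p₀ ≤ (((h z).toReal - inner ℝ ξ₀ (z - p₀) : ℝ) : EReal) := by
    intro z hz
    by_contra! hlt
    obtain ⟨r, hr, hr'⟩ := EReal.lt_iff_exists_real_btwn.1 hlt
    have hlim : Tendsto (fun k => (h z).toReal - inner ℝ (ξ k) (z - p k)) atTop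
        (𝓝 ((h z).toReal - inner ℝ ξ₀ (z - p₀))) :=
      (hξ.inner (hp.const_sub z)).const_sub _
    obtain ⟨k, hk, hk'⟩ := ((hp.eventually (hlsc p₀ r hr')).and
      (hlim.eventually (gt_mem_nhds (EReal.coe_lt_coe_iff.1 hr)))).exists
    have e := (hmem k).2 z
    rw [← EReal.coe_toReal (hmem k).1 (hbot _)] at e hk
    rw [← EReal.coe_toReal hz (hbot _)] at e
    norm_cast at e hk
    linarith
  obtain ⟨z₀, hz₀⟩ := htop
  have hfin : h p₀ ≠ ⊤ := ((key z₀ hz₀).trans_lt (EReal.coe_lt_top _)).ne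
  refine ⟨hfin, fun z => ?_⟩
  by_cases hz : h z = ⊤
  · rw [hz]
    exact le_top
  have e := key z hz
  rw [← EReal.coe_toReal hfin (hbot _)] at e ⊢
  rw [← EReal.coe_toReal hz (hbot _)]
  norm_cast at e ⊢
  linarith

theorem ne_top_of_isMinOn {h : E n → EReal} (htop : ∃ x, h x ≠ ⊤) {q : E n → ℝ} {p : E n}
    (hp : IsMinOn (fun z => h z + ((q z : ℝ) : EReal)) Set.univ p) : h p ≠ ⊤ := by
  intro hpt
  obtain ⟨z, hz⟩ := htop
  have e : h p + ((q p : ℝ) : EReal) ≤ h z + ((q z : ℝ) : EReal) := hp (Set.mem_univ z)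
  rw [hpt, EReal.top_add_coe, top_le_iff] at e
  exact EReal.add_ne_top hz (EReal.coe_ne_top _) e

/-- First-order optimality: a minimizer of a convex function plus a (possibly indefinite) quadratic
one. -/
theorem mem_subdiff_of_isMinOn {h : E n → EReal} (hbot : ∀ x, h x ≠ ⊥) (htop : ∃ x, h x ≠ ⊤)
    (hconv : Convex ℝ {p : E n × ℝ | h p.1 ≤ (p.2 : EReal)}) {M : Matrix (Fin n) (Fin n) ℝ}
    (hM : (Matrix.toEuclideanLin M).IsSymmetric) {c x₀ p : E n}
    (hp : IsMinOn (fun z => h z +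
      ((inner ℝ c z + 1 / 2 * normSq M (z - x₀) : ℝ) : EReal)) Set.univ p) :
    -c - act M (p - x₀) ∈ subdiff h p := by
  have hfin := ne_top_of_isMinOn htop hp
  refine ⟨hfin, fun z => ?_⟩
  by_cases hz : h z = ⊤
  · rw [hz]
    exact le_top
  have hz' := EReal.coe_toReal hz (hbot _)
  have hp' := EReal.coe_toReal hfin (hbot _)
  set α := (h p).toReal
  set β := (h z).toReal
  -- Minimality is tested along the segment from p to z and divided by t. The curvature of M enters
  -- only at order t, so its sign is irrelevant as t → 0.
  have key : ∀ t : ℝ, 0 < t → t ≤ 1 →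
      α - β + inner ℝ (-c - act M (p - x₀)) (z - p) ≤ t * (1 / 2 * normSq M (z - p)) := by
    intro t ht ht1
    have hc : h (p + t • (z - p)) ≤ ((1 - t) * α + t * β : ℝ) := by
      have := hconv (x := (p, α)) hp'.ge (y := (z, β)) hz'.ge (sub_nonneg.2 ht1) ht.le (by ring)
      have e : p + t • (z - p) = (1 - t) • p + t • z := by
        rw [smul_sub, sub_smul, one_smul]
        abel
      rw [e]
      simpa using this
    have hmin : h p + ((inner ℝ c p + 1 / 2 * normSq M (p - x₀) : ℝ) : EReal) ≤ _ :=
      hp (Set.mem_univ (p + t • (z - p)))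
    have hle := hmin.trans (add_le_add_left hc _)
    rw [← hp', show p + t • (z - p) - x₀ = (p - x₀) + t • (z - p) by abel] at hle
    norm_cast at hle
    have e := inner_map_add_self hM (p - x₀) (t • (z - p))
    have s := hM (p - x₀) (z - p)
    simp only [map_smul, real_inner_smul_left, real_inner_smul_right] at e
    rw [normSq, normSq, e, inner_add_right, real_inner_smul_right] at hle
    rw [inner_sub_left, inner_neg_left, s, normSq]
    have : t * (α - β + (-inner ℝ c (z - p) - inner ℝ (p - x₀) (act M (z - p)))) ≤
        t * (t * (1 / 2 * inner ℝ (z - p) (act M (z - p)))) := by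
      linarith
    exact le_of_mul_le_mul_left this ht
  have hlim : Tendsto (fun t : ℝ => t * (1 / 2 * normSq M (z - p))) (𝓝[>] 0) (𝓝 0) := by
    have : Tendsto (fun t : ℝ => t * (1 / 2 * normSq M (z - p))) (𝓝 0)
      (𝓝 (0 * (1 / 2 * normSq M (z - p)))) := tendsto_id.mul_const _
    rw [zero_mul] at this
    exact this.mono_left nhdsWithin_le_nhds
  have h0 := ge_of_tendsto hlim (a := 0) (f := fun t : ℝ => t * (1 / 2 * normSq M (z - p)))
    (b := α - β + inner ℝ (-c - act M (p - x₀)) (z - p)) <| by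
      filter_upwards [Ioc_mem_nhdsGT (zero_lt_one' ℝ)] with t ht using key t ht.1 ht.2
  rw [← hp', ← hz']
  norm_cast
  linarith

/-- Points with g z = ⊤ contribute ⊥ to the supremum, leaving a family of real affine inequalities.
-/
theorem conj_le_iff {g : E m → EReal} (hbot : ∀ x, g x ≠ ⊥) {y : E m} {r : ℝ} :
    conj g y ≤ r ↔ ∀ z, g z ≠ ⊤ → inner ℝ z y - (g z).toReal ≤ r := by
  rw [conj, iSup_le_iff]
  refine forall_congr' fun z => ?_
  by_cases hz : g z = ⊤
  · simp [hz]
  · rw [← EReal.coe_toReal hz (hbot z)]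
    norm_cast
    simp

theorem conj_ne_bot {g : E m → EReal} (htop : ∃ x, g x ≠ ⊤) (hbot : ∀ x, g x ≠ ⊥) (y : E m) :
    conj g y ≠ ⊥ := by
  obtain ⟨z, hz⟩ := htop
  have : ((inner ℝ z y : ℝ) : EReal) - g z ≤ conj g y :=
    le_iSup (fun z : E m => ((inner ℝ z y : ℝ) : EReal) - g z) z
  rw [← EReal.coe_toReal hz (hbot z), ← EReal.coe_sub] at this
  exact ((EReal.bot_lt_coe _).trans_le this).ne'

theorem conj_lsc {g : E m → EReal} (hbot : ∀ x, g x ≠ ⊥) : LowerSemicontinuous (conj g) := by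
  unfold conj
  refine lowerSemicontinuous_iSup fun z => ?_
  by_cases hz : g z = ⊤
  · simpa [hz] using lowerSemicontinuous_const
  · rw [← EReal.coe_toReal hz (hbot z)]
    refine Continuous.lowerSemicontinuous ?_
    simp only [← EReal.coe_sub]
    exact continuous_coe_real_ereal.comp (by fun_prop)

theorem conj_convex {g : E m → EReal} (hbot : ∀ x, g x ≠ ⊥) :
    Convex ℝ {p : E m × ℝ | conj g p.1 ≤ (p.2 : EReal)} := by
  intro p hp q hq a b ha hb hab
  simp only [Set.mem_ofPred_eq, conj_le_iff hbot] at hp hq ⊢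
  intro z hz
  have e1 := mul_le_mul_of_nonneg_left (hp z hz) ha
  have e2 := mul_le_mul_of_nonneg_left (hq z hz) hb
  simp only [Prod.fst_add, Prod.snd_add, Prod.smul_fst, Prod.smul_snd, inner_add_right,
    real_inner_smul_right, smul_eq_mul]
  calc _ = a * (inner ℝ z p.1 - (g z).toReal) + b * (inner ℝ z q.1 - (g z).toReal) := by
        linear_combination (g z).toReal * hab
    _ ≤ _ := add_le_add e1 e2

/-- Saddle points are the solutions of the inclusions `-Kᵀ y ∈ ∂f(x)`, `K x ∈ ∂g*(y)`. -/
theorem isSaddlePoint_iff {f : E n → EReal} {g : E m → EReal} {K : Matrix (Fin m) (Fin n) ℝ}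
    (hf : ∀ x, f x ≠ ⊥) (hg : ∀ y, conj g y ≠ ⊥) {Kt : E m →ₗ[ℝ] E n}
    (hK : ∀ x y, inner ℝ (act K x) y = inner ℝ x (Kt y)) {xs : E n} {ys : E m} :
    IsSaddlePoint f g K xs ys ↔ -(Kt ys) ∈ subdiff f xs ∧ act K xs ∈ subdiff (conj g) ys := by
  have main : ∀ (hx : f xs ≠ ⊤) (hy : conj g ys ≠ ⊤),
      ((∀ y, lagrangian f g K xs y ≤ lagrangian f g K xs ys) ↔
        ∀ y, conj g ys + ((inner ℝ (act K xs) (y - ys) : ℝ) : EReal) ≤ conj g y) ∧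
      ((∀ x, lagrangian f g K xs ys ≤ lagrangian f g K x ys) ↔
        ∀ x, f xs + ((inner ℝ (-(Kt ys)) (x - xs) : ℝ) : EReal) ≤ f x) := by
    intro hx hy
    unfold lagrangian
    refine ⟨forall_congr' fun y => ?_, forall_congr' fun x => ?_⟩
    · by_cases h : conj g y = ⊤
      · simp [h]
      · rw [← EReal.coe_toReal hx (hf _), ← EReal.coe_toReal hy (hg _),
          ← EReal.coe_toReal h (hg _)]
        norm_cast
        rw [inner_sub_right]
        constructor <;> intro <;> linarith
    · by_cases h : f x = ⊤
      · rw [h, EReal.top_add_coe, ← EReal.coe_toReal hy (hg _), EReal.top_sub_coe]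
        simp
      · rw [← EReal.coe_toReal hx (hf _), ← EReal.coe_toReal hy (hg _),
          ← EReal.coe_toReal h (hf _)]
        have e : inner ℝ (Kt ys) (x - xs) = inner ℝ (act K x) ys - inner ℝ (act K xs) ys := by
          rw [real_inner_comm, ← hK, act, map_sub, inner_sub_left]
        norm_cast
        rw [inner_neg_left, e]
        constructor <;> intro <;> linarith
  constructor
  · rintro ⟨hx, hy, h₁, h₂⟩
    exact ⟨⟨hx, (main hx hy).2.1 h₂⟩, ⟨hy, (main hx hy).1.1 h₁⟩⟩
  · rintro ⟨⟨hx, h₁⟩, ⟨hy, h₂⟩⟩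
    exact ⟨hx, hy, (main hx hy).1.2 h₂, (main hx hy).2.2 h₁⟩

end Subdifferential

/-! ### Matrices as linear maps and the spectral norm -/

section Matrices

variable {n m : ℕ}

theorem act_adjoint (K : Matrix (Fin m) (Fin n) ℝ) (x : E n) (y : E m) :
    inner ℝ (act K x) y = inner ℝ x (act Kᵀ y) := by
  rw [← Matrix.conjTranspose_eq_transpose_of_trivial, act, act,
    Matrix.toEuclideanLin_conjTranspose_eq_adjoint, LinearMap.adjoint_inner_right]

theorem act_mul {l : ℕ} (A : Matrix (Fin m) (Fin n) ℝ) (B : Matrix (Fin n) (Fin l) ℝ) (x : E l) :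
    act (A * B) x = act A (act B x) := by
  simp [act, Matrix.toEuclideanLin]

theorem act_one (x : E n) : act 1 x = x := by
  simp [act, Matrix.toEuclideanLin]

theorem act_isSymmetric {M : Matrix (Fin n) (Fin n) ℝ} (hM : M.IsSymm) :
    (Matrix.toEuclideanLin M).IsSymmetric := by
  intro a b
  have := act_adjoint M a b
  rwa [hM.eq] at this

theorem inner_act (M : Matrix (Fin n) (Fin n) ℝ) (z : E n) :
    inner ℝ z (act M z) = star z.ofLp ⬝ᵥ (M *ᵥ z.ofLp) := by
  rw [EuclideanSpace.inner_eq_star_dotProduct, dotProduct_comm]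
  rfl

theorem normSq_pos {M : Matrix (Fin n) (Fin n) ℝ} (hM : M.PosDef) {z : E n} (hz : z ≠ 0) :
    0 < inner ℝ z (act M z) := by
  rw [inner_act]
  exact hM.dotProduct_mulVec_pos (by simpa using hz)

theorem normSq_nonneg {M : Matrix (Fin n) (Fin n) ℝ} (hM : M.PosSemidef) (z : E n) :
    0 ≤ inner ℝ z (act M z) := by
  rw [inner_act]
  exact hM.dotProduct_mulVec_nonneg _

theorem invSqrt_mul_self {M : Matrix (Fin n) (Fin n) ℝ} (hM : M.PosDef) :
    invSqrt M * invSqrt M = M⁻¹ :=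
  CFC.sqrt_mul_sqrt_self _ hM.inv.posSemidef.nonneg

theorem invSqrt_symm (M : Matrix (Fin n) (Fin n) ℝ) : (invSqrt M).IsSymm := by
  have := (Matrix.nonneg_iff_posSemidef.1 (CFC.sqrt_nonneg M⁻¹)).isHermitian
  rwa [Matrix.IsHermitian, Matrix.conjTranspose_eq_transpose_of_trivial] at this

theorem norm_act_le (A : Matrix (Fin m) (Fin n) ℝ) (x : E n) : ‖act A x‖ ≤ specNorm A * ‖x‖ :=
  (LinearMap.toContinuousLinearMap (Matrix.toEuclideanLin A)).le_opNorm x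

/-- The spectral norm bound as an inequality between quadratic forms. -/
theorem inner_inv_le {K : Matrix (Fin m) (Fin n) ℝ} {A : Matrix (Fin n) (Fin n) ℝ}
    {M : Matrix (Fin m) (Fin m) ℝ} (hA : A.PosDef) (hM : M.PosDef) (x : E n) :
    inner ℝ (act K x) (act M⁻¹ (act K x)) ≤
      specNorm (invSqrt M * K * invSqrt A) ^ 2 * inner ℝ x (act A x) := by
  have hAinv : A⁻¹ * A = 1 := Matrix.nonsing_inv_mul _ ((Matrix.isUnit_iff_isUnit_det _).1 hA.isUnit)
  -- The test vector is A^{-1/2}A x: its squared norm is ⟨x, A x⟩, and A^{-1/2} sends it to x.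
  have key := norm_act_le (invSqrt M * K * invSqrt A) (act (invSqrt A) (act A x))
  have e1 : act (invSqrt A) (act (invSqrt A) (act A x)) = x := by
    rw [← act_mul, ← act_mul, invSqrt_mul_self hA, hAinv, act_one]
  rw [act_mul, act_mul, e1] at key
  have e2 : ‖act (invSqrt A) (act A x)‖ ^ 2 = inner ℝ x (act A x) := by
    rw [← real_inner_self_eq_norm_sq, act_adjoint, (invSqrt_symm A).eq, e1, real_inner_comm]
  have e3 : ‖act (invSqrt M) (act K x)‖ ^ 2 = inner ℝ (act K x) (act M⁻¹ (act K x)) := by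
    rw [← real_inner_self_eq_norm_sq, act_adjoint, (invSqrt_symm M).eq,
      ← act_mul (invSqrt M) (invSqrt M), invSqrt_mul_self hM]
  rw [← e2, ← e3, ← mul_pow]
  gcongr

end Matrices

/-! ### Convergence for ρ ≤ 1/2 -/

/-- Convergence of the preconditioned primal-dual hybrid gradient method for `ρ ≤ 1 / 2`. -/
theorem exists_tendsto_saddlePoint {ρ : ℝ} (hρ : ρ ≤ 1 / 2) {n m : ℕ} {f : E n → EReal}
    {g : E m → EReal} {K : Matrix (Fin m) (Fin n) ℝ} {S M₁ : Matrix (Fin n) (Fin n) ℝ}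
    {M₂ : Matrix (Fin m) (Fin m) ℝ} (hP : IsProblem f g K S) (hC : ParamCondition ρ K S M₁ M₂)
    {x : ℕ → E n} {y : ℕ → E m} (hG : IsGenerated f g K M₁ M₂ x y) :
    ∃ xs ys, IsSaddlePoint f g K xs ys ∧ Tendsto x atTop (𝓝 xs) ∧ Tendsto y atTop (𝓝 ys) := by
  have hfb := hP.f_convex.ne_bot
  have hgb := conj_ne_bot hP.g_convex.exists_ne_top hP.g_convex.ne_bot
  have hsad : ∀ {xs ys}, IsSaddlePoint f g K xs ys ↔ _ := fun {xs ys} =>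
    isSaddlePoint_iff (xs := xs) (ys := ys) hfb hgb (act_adjoint K)
  -- Properness of the conjugate is read off from the saddle point.
  have hgt : ∃ w, conj g w ≠ ⊤ := by
    obtain ⟨xs, ys, h⟩ := hP.exists_saddle
    exact ⟨ys, h.mem_dom_conj⟩
  have hsymm : S.IsSymm := by
    have := hP.sigma.posSemidef.isHermitian
    rwa [Matrix.IsHermitian, Matrix.conjTranspose_eq_transpose_of_trivial] at this
  have hdet : IsUnit M₂.det := (Matrix.isUnit_iff_isUnit_det _).1 hC.posDef₂.isUnit
  have hinv : (M₂⁻¹).IsSymm := by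
    rw [Matrix.IsSymm, Matrix.transpose_nonsing_inv, hC.symm₂.eq]
  -- As S ⪰ 0 and ρ ≤ 1/2, positivity and the norm bound pass from ρ to 1/2.
  have hle : ∀ z, inner ℝ z (act (M₁ + ρ • S) z) ≤
      inner ℝ z ((Matrix.toEuclideanLin M₁ + (1 / 2 : ℝ) • Matrix.toEuclideanLin S) z) := by
    intro z
    have := mul_nonneg (sub_nonneg.2 hρ) (normSq_nonneg hP.sigma.posSemidef z)
    simp only [act, map_add, map_smul, LinearMap.add_apply, LinearMap.smul_apply, inner_add_right,
      real_inner_smul_right]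
    linarith
  have it : Iteration (subdiff f) (subdiff (conj g)) (Matrix.toEuclideanLin M₁)
      (Matrix.toEuclideanLin S) (Matrix.toEuclideanLin M₂) (Matrix.toEuclideanLin M₂⁻¹)
      (Matrix.toEuclideanLin K) (Matrix.toEuclideanLin Kᵀ)
      (specNorm (invSqrt M₂ * K * invSqrt (M₁ + ρ • S)) ^ 2) x y :=
    { symm_M₁ := act_isSymmetric hC.symm₁
      symm_S := act_isSymmetric hsymm
      symm_M₂ := act_isSymmetric hC.symm₂
      symm_N := act_isSymmetric hinv
      M₂_N := fun w => by
        have := act_mul M₂ M₂⁻¹ w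
        rw [Matrix.mul_nonsing_inv _ hdet, act_one] at this
        exact this.symm
      N_M₂ := fun w => by
        have := act_mul M₂⁻¹ M₂ w
        rw [Matrix.nonsing_inv_mul _ hdet, act_one] at this
        exact this.symm
      adjoint := act_adjoint K
      nonneg_S := normSq_nonneg hP.sigma.posSemidef
      pos₁ := fun z hz => (normSq_pos hC.posDef₁ hz).trans_le (hle z)
      pos₂ := fun w hw => normSq_pos hC.posDef₂ hw
      lt := hC.norm_lt
      bound := fun z => (inner_inv_le hC.posDef₁ hC.posDef₂ z).trans
        (mul_le_mul_of_nonneg_left (hle z) (sq_nonneg _))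
      mono_f := hP.sigma.monotone
      mono_g := fun _ _ _ h₁ _ h₂ => subdiff_mono hgb h₁ h₂
      step_x := fun k => by
        refine mem_subdiff_of_isMinOn hfb hP.f_convex.exists_ne_top hP.f_convex.convex
          (act_isSymmetric hC.symm₁) (c := act Kᵀ (y k)) ?_
        simpa only [act_adjoint K, real_inner_comm (act Kᵀ (y k))] using hG.x_step k
      step_y := fun k => by
        have := mem_subdiff_of_isMinOn hgb hgt (conj_convex hP.g_convex.ne_bot)
          (act_isSymmetric hC.symm₂) (c := -act K ((2 : ℝ) • x (k + 1) - x k)) (x₀ := y k)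
          (p := y (k + 1)) (by simpa only [inner_neg_left] using hG.y_step k)
        rwa [neg_neg] at this }
  obtain ⟨xs, ys, h, hx, hy⟩ := it.exists_tendsto
    (subdiff_closed hfb hP.f_convex.exists_ne_top hP.f_convex.lsc)
    (subdiff_closed hgb hgt (conj_lsc hP.g_convex.ne_bot)) (by
      obtain ⟨xs, ys, h⟩ := hP.exists_saddle
      exact ⟨xs, ys, hsad.1 h⟩)
  exact ⟨xs, ys, hsad.2 h, hx, hy⟩

/-! ### The one-dimensional counterexample -/

section Example

theorem inner_one (x y : E 1) : inner ℝ x y = x 0 * y 0 := by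
  simp [PiLp.inner_apply, mul_comm]

theorem normSq_smul_one (c : ℝ) (z : E 1) : normSq (c • 1) z = c * z 0 ^ 2 := by
  rw [normSq, act, map_smul, LinearMap.smul_apply, real_inner_smul_right]
  change c * inner ℝ z (act 1 z) = _
  rw [act_one, inner_one]
  ring

theorem exF_ne_bot (x : E 1) : exF x ≠ ⊥ := EReal.coe_ne_bot _

theorem exG_ne_bot (z : E 1) : exG z ≠ ⊥ := by
  unfold exG
  split_ifs <;> simp

theorem exG_zero : exG 0 = 0 := by simp [exG]

theorem exG_ne_top_iff {z : E 1} : exG z ≠ ⊤ ↔ z = 0 := by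
  unfold exG
  split_ifs with h <;> simp [h]

theorem conj_exG (w : E 1) : conj exG w = 0 := by
  refine le_antisymm ?_ ?_
  · have : conj exG w ≤ ((0 : ℝ) : EReal) := by
      rw [conj_le_iff exG_ne_bot]
      intro z hz
      rw [exG_ne_top_iff.1 hz, exG_zero]
      simp
    exact this
  · have := le_iSup (fun z : E 1 => ((inner ℝ z w : ℝ) : EReal) - exG z) 0
    rwa [inner_zero_left, exG_zero, EReal.coe_zero, sub_zero] at this

theorem exF_properClosedConvex : IsProperClosedConvex exF where
  ne_bot := exF_ne_bot
  exists_ne_top := ⟨0, EReal.coe_ne_top _⟩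
  lsc := (continuous_coe_real_ereal.comp (by fun_prop)).lowerSemicontinuous
  convex := by
    intro p hp q hq a b ha hb hab
    simp only [Set.mem_ofPred_eq, exF, EReal.coe_le_coe_iff, Prod.fst_add, Prod.snd_add,
      Prod.smul_fst, Prod.smul_snd, PiLp.add_apply, PiLp.smul_apply, smul_eq_mul] at hp hq ⊢
    obtain rfl : b = 1 - a := by linarith
    have e1 := mul_le_mul_of_nonneg_left hp ha
    have e2 := mul_le_mul_of_nonneg_left hq hb
    have e3 := mul_nonneg (mul_nonneg ha hb) (sq_nonneg (p.1 0 - q.1 0))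
    nlinarith

theorem exG_properClosedConvex : IsProperClosedConvex exG where
  ne_bot := exG_ne_bot
  exists_ne_top := ⟨0, by simp [exG_zero]⟩
  lsc := by
    intro x r hr
    unfold exG at hr ⊢
    split_ifs at hr with h
    · filter_upwards with z
      split_ifs
      · exact hr
      · exact hr.trans EReal.zero_lt_top
    · filter_upwards [isOpen_compl_singleton.mem_nhds h] with z hz
      rwa [if_neg (show z ≠ 0 from hz)]
  convex := by
    have : {p : E 1 × ℝ | exG p.1 ≤ (p.2 : EReal)} = {0} ×ˢ Set.Ici 0 := by
      ext ⟨z, r⟩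
      unfold exG
      by_cases h : z = 0 <;> simp [h]
    rw [this]
    exact (convex_singleton 0).prod (convex_Ici 0)

/-- Testing the subgradient inequality at the point ξ gives (ξ - x)² ≤ 0. -/
theorem subdiff_exF {x ξ : E 1} (h : ξ ∈ subdiff exF x) : ξ 0 = x 0 := by
  have e := h.2 (EuclideanSpace.single 0 (ξ 0))
  rw [exF, exF, inner_one] at e
  norm_cast at e
  simp only [PiLp.sub_apply, PiLp.single_apply, if_true] at e
  nlinarith [sq_nonneg (ξ 0 - x 0)]

theorem isSigma_exF : IsSigma exF 1 where
  posSemidef := Matrix.PosSemidef.one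
  monotone := by
    intro x₁ x₂ ξ₁ h₁ ξ₂ h₂
    have := normSq_smul_one 1 (x₁ - x₂)
    rw [one_smul, one_mul] at this
    rw [this, inner_one, PiLp.sub_apply, PiLp.sub_apply, subdiff_exF h₁, subdiff_exF h₂]
    exact (pow_two _).le

theorem lagrangian_example (x y : E 1) :
    lagrangian exF exG 1 x y = ((1 / 2 * (x 0) ^ 2 + x 0 * y 0 : ℝ) : EReal) := by
  rw [lagrangian, conj_exG, act_one, inner_one, exF, sub_zero]
  norm_cast

theorem isProblem_example : IsProblem exF exG 1 1 where
  f_convex := exF_properClosedConvex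
  g_convex := exG_properClosedConvex
  sigma := isSigma_exF
  exists_saddle := by
    refine ⟨0, 0, EReal.coe_ne_top _, by simp [conj_exG], fun y => ?_, fun x => ?_⟩
    · simp [lagrangian_example]
    · rw [lagrangian_example, lagrangian_example]
      norm_cast
      simp only [PiLp.zero_apply]
      nlinarith [sq_nonneg (x 0)]

theorem isMinOn_quadratic_iff {a b c : ℝ} (ha : 0 < a) {q : E 1 → EReal} {p : E 1}
    (hq : ∀ z, q z = ((1 / 2 * a * z 0 ^ 2 + b * z 0 + c : ℝ) : EReal)) :
    IsMinOn q Set.univ p ↔ a * p 0 + b = 0 := by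
  constructor
  · intro h
    -- Comparison with the vertex of the parabola.
    have e : q p ≤ q (EuclideanSpace.single 0 (-b / a)) := h (Set.mem_univ _)
    rw [hq, hq] at e
    norm_cast at e
    rw [PiLp.single_apply, if_pos rfl] at e
    have e' : 1 / 2 * a * (-b / a) ^ 2 + b * (-b / a) = -(1 / 2) * (b ^ 2 / a) := by
      field_simp
      ring
    have : (a * p 0 + b) ^ 2 ≤ 0 := by
      have hb : a * (b ^ 2 / a) = b ^ 2 := by field_simp
      have := mul_le_mul_of_nonneg_left e ha.le
      nlinarith
    exact pow_eq_zero_iff two_ne_zero |>.1 (le_antisymm this (sq_nonneg _))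
  · intro h z _
    change q p ≤ q z
    rw [hq, hq]
    norm_cast
    have hb : b = -(a * p 0) := by linarith
    have := mul_nonneg ha.le (sq_nonneg (z 0 - p 0))
    rw [hb]
    nlinarith

theorem isGenerated_example_iff {τ σ : ℝ} (hτ : 0 < τ) (hσ : 0 < σ) (x y : ℕ → E 1) :
    IsGenerated exF exG 1 (τ⁻¹ • 1) (σ⁻¹ • 1) x y ↔
      ∀ k, ![x (k + 1) 0, y (k + 1) 0] = (exIter τ σ).mulVec ![x k 0, y k 0] := by
  have hx : ∀ k, IsMinOn (fun z : E 1 => exF z +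
      ((inner ℝ (act 1 z) (y k) + 1 / 2 * normSq (τ⁻¹ • 1) (z - x k) : ℝ) : EReal))
      Set.univ (x (k + 1)) ↔ (1 + τ⁻¹) * x (k + 1) 0 + (y k 0 - τ⁻¹ * x k 0) = 0 := by
    intro k
    refine isMinOn_quadratic_iff (c := 1 / 2 * τ⁻¹ * x k 0 ^ 2) (by positivity) fun z => ?_
    rw [exF, act_one, inner_one, normSq_smul_one, PiLp.sub_apply, ← EReal.coe_add]
    congr 1
    ring
  have hy : ∀ k, IsMinOn (fun w : E 1 => conj exG w +
      ((-inner ℝ (act 1 ((2 : ℝ) • x (k + 1) - x k)) w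
        + 1 / 2 * normSq (σ⁻¹ • 1) (w - y k) : ℝ) : EReal)) Set.univ (y (k + 1)) ↔
      σ⁻¹ * y (k + 1) 0 + (-(2 * x (k + 1) 0 - x k 0) - σ⁻¹ * y k 0) = 0 := by
    intro k
    refine isMinOn_quadratic_iff (c := 1 / 2 * σ⁻¹ * y k 0 ^ 2) (by positivity) fun z => ?_
    rw [conj_exG, act_one, inner_one, normSq_smul_one, zero_add]
    congr 1
    simp only [PiLp.sub_apply, PiLp.smul_apply, smul_eq_mul]
    ring
  have hstep : ∀ k, ((1 + τ⁻¹) * x (k + 1) 0 + (y k 0 - τ⁻¹ * x k 0) = 0 ∧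
      σ⁻¹ * y (k + 1) 0 + (-(2 * x (k + 1) 0 - x k 0) - σ⁻¹ * y k 0) = 0) ↔
      ![x (k + 1) 0, y (k + 1) 0] = (exIter τ σ).mulVec ![x k 0, y k 0] := by
    intro k
    have hτ' : 1 + τ ≠ 0 := by positivity
    have e1 : (1 + τ⁻¹) * x (k + 1) 0 + (y k 0 - τ⁻¹ * x k 0) =
        τ⁻¹ * ((1 + τ) * x (k + 1) 0 - (x k 0 - τ * y k 0)) := by
      field_simp
      ring
    have e2 : σ⁻¹ * y (k + 1) 0 + (-(2 * x (k + 1) 0 - x k 0) - σ⁻¹ * y k 0) =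
        σ⁻¹ * (y (k + 1) 0 - σ * (2 * x (k + 1) 0 - x k 0) - y k 0) := by
      field_simp
      ring
    have e3 : (exIter τ σ).mulVec ![x k 0, y k 0] = ![(x k 0 - τ * y k 0) / (1 + τ),
        (σ * (1 - τ) * x k 0 + (1 + τ - 2 * τ * σ) * y k 0) / (1 + τ)] := by
      ext i
      fin_cases i <;> simp [exIter, Matrix.mulVec, dotProduct,
        Fin.sum_univ_two] <;> ring
    rw [e1, e2, e3, mul_eq_zero, mul_eq_zero, or_iff_right (inv_pos.2 hτ).ne',
      or_iff_right (inv_pos.2 hσ).ne']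
    -- Eliminating the new x from the extrapolated y-update yields the second row.
    simp only [Matrix.vecCons_inj, eq_div_iff hτ', and_true]
    constructor
    · rintro ⟨h₁, h₂⟩
      exact ⟨by linarith, by linear_combination (1 + τ) * h₂ + 2 * σ * h₁⟩
    · rintro ⟨h₁, h₂⟩
      refine ⟨by linarith, mul_left_cancel₀ hτ' ?_⟩
      linear_combination h₂ - 2 * σ * h₁
  refine ⟨fun h k => (hstep k).1 ⟨(hx k).1 (h.x_step k), (hy k).1 (h.y_step k)⟩, fun h =>
    ⟨fun k => (hx k).2 ((hstep k).2 (h k)).1, fun k => (hy k).2 ((hstep k).2 (h k)).2⟩⟩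

theorem invSqrt_smul_one {n : ℕ} {c : ℝ} (hc : 0 < c) :
    invSqrt (c • 1 : Matrix (Fin n) (Fin n) ℝ) = (√c)⁻¹ • 1 := by
  have h1 : ((c • 1 : Matrix (Fin n) (Fin n) ℝ))⁻¹ = c⁻¹ • 1 := by
    refine Matrix.inv_eq_right_inv ?_
    rw [smul_mul_smul_comm, mul_one, mul_inv_cancel₀ hc.ne', one_smul]
  rw [invSqrt, h1]
  refine CFC.sqrt_unique ?_ ?_
  · rw [smul_mul_smul_comm, mul_one, ← mul_inv, Real.mul_self_sqrt hc.le]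
  · exact (Matrix.PosSemidef.one.smul (by positivity)).nonneg

theorem specNorm_smul_one_le {n : ℕ} (c : ℝ) :
    specNorm (c • 1 : Matrix (Fin n) (Fin n) ℝ) ≤ |c| := by
  refine ContinuousLinearMap.opNorm_le_bound _ (abs_nonneg c) fun x => ?_
  change ‖Matrix.toEuclideanLin (c • 1 : Matrix (Fin n) (Fin n) ℝ) x‖ ≤ _
  rw [map_smul, LinearMap.smul_apply, norm_smul, Real.norm_eq_abs]
  exact (congrArg (fun z => |c| * ‖z‖) (act_one x)).le

/-- For scalar matrices the squared norm is at most σ / (τ⁻¹ + ρ); an upper bound suffices. -/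
theorem paramCondition_example {ρ τ σ : ℝ} (hσ : 0 < σ) (hρ : 0 < τ⁻¹ + ρ)
    (hlt : σ < 4 / 3 * (τ⁻¹ + ρ)) :
    ParamCondition (n := 1) (m := 1) ρ 1 1 (τ⁻¹ • 1) (σ⁻¹ • 1) where
  symm₁ := by simp [Matrix.IsSymm]
  symm₂ := by simp [Matrix.IsSymm]
  posDef₁ := by
    rw [← add_smul]
    exact Matrix.PosDef.one.smul hρ
  posDef₂ := Matrix.PosDef.one.smul (inv_pos.2 hσ)
  norm_lt := by
    rw [← add_smul, invSqrt_smul_one hρ, invSqrt_smul_one (inv_pos.2 hσ), mul_one,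
      smul_mul_smul_comm, mul_one]
    refine (pow_le_pow_left₀ (norm_nonneg _) (specNorm_smul_one_le _) 2).trans_lt ?_
    rw [sq_abs, mul_pow, inv_pow, inv_pow, Real.sq_sqrt (inv_pos.2 hσ).le, Real.sq_sqrt hρ.le,
      inv_inv, ← div_eq_mul_inv, div_lt_iff₀ hρ]
    exact hlt

/-- At τ = 1 the matrix is upper triangular with diagonal 1/2, 1 - σ. -/
theorem exIter_one_mulVec (σ : ℝ) :
    (exIter 1 σ).mulVec ![1, 2 * σ - 1] = (1 - σ) • ![1, 2 * σ - 1] := by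
  ext i
  fin_cases i
  · simp [exIter, Matrix.mulVec, dotProduct, Fin.sum_univ_two]
    ring
  · simp [exIter, Matrix.mulVec, dotProduct, Fin.sum_univ_two]
    left
    ring

theorem not_tendsto_pow {μ : ℝ} (hμ : μ < -1) (l : ℝ) :
    ¬ Tendsto (fun k : ℕ => μ ^ k) atTop (𝓝 l) := by
  intro h
  have h' := h.abs
  simp only [abs_pow] at h'
  exact not_tendsto_nhds_of_tendsto_atTop
    (tendsto_pow_atTop_atTop_of_one_lt (by rw [abs_of_neg] <;> linarith)) _ h'

end Example
end PrePDHG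

theorem lemma3p4 :
    (∀ ρ₂ : ℝ, ρ₂ ≤ 1 / 2 →
      ∀ (n m : ℕ) (f : PrePDHG.E n → EReal) (g : PrePDHG.E m → EReal)
        (K : Matrix (Fin m) (Fin n) ℝ) (S M₁ : Matrix (Fin n) (Fin n) ℝ)
        (M₂ : Matrix (Fin m) (Fin m) ℝ),
        PrePDHG.IsProblem f g K S →
        PrePDHG.ParamCondition ρ₂ K S M₁ M₂ →
        ∀ (x : ℕ → PrePDHG.E n) (y : ℕ → PrePDHG.E m),
          PrePDHG.IsGenerated f g K M₁ M₂ x y →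
          ∃ (xs : PrePDHG.E n) (ys : PrePDHG.E m),
            PrePDHG.IsSaddlePoint f g K xs ys ∧
            Filter.Tendsto x Filter.atTop (nhds xs) ∧
            Filter.Tendsto y Filter.atTop (nhds ys)) ∧
    (∀ ρ₂ : ℝ, 1 / 2 < ρ₂ →
      PrePDHG.IsProblem PrePDHG.exF PrePDHG.exG 1 1 ∧
      (∀ x y : PrePDHG.E 1, PrePDHG.lagrangian PrePDHG.exF PrePDHG.exG 1 x y
        = ((1 / 2 * (x 0) ^ 2 + x 0 * y 0 : ℝ) : EReal)) ∧
      ∃ τ σ : ℝ, 0 < τ ∧ 0 < σ ∧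
        PrePDHG.ParamCondition (n := 1) (m := 1) ρ₂ 1 1 (τ⁻¹ • 1) (σ⁻¹ • 1) ∧
        (∀ (x y : ℕ → PrePDHG.E 1),
          PrePDHG.IsGenerated PrePDHG.exF PrePDHG.exG 1 (τ⁻¹ • 1) (σ⁻¹ • 1) x y ↔
          ∀ k, ![x (k + 1) 0, y (k + 1) 0]
            = (PrePDHG.exIter τ σ).mulVec ![x k 0, y k 0]) ∧
        (∃ μ : ℝ, μ < -1 ∧
          Module.End.HasEigenvalue (Matrix.toLin' (PrePDHG.exIter τ σ)) μ) ∧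
        ∃ (x y : ℕ → PrePDHG.E 1),
          PrePDHG.IsGenerated PrePDHG.exF PrePDHG.exG 1 (τ⁻¹ • 1) (σ⁻¹ • 1) x y ∧
          ¬ ∃ p : PrePDHG.E 1 × PrePDHG.E 1,
            Filter.Tendsto (fun k => (x k, y k)) Filter.atTop (nhds p)) := by
  refine ⟨fun ρ hρ n m f g K S M₁ M₂ hP hC x y hG =>
    PrePDHG.exists_tendsto_saddlePoint hρ hP hC hG, fun ρ hρ =>
    ⟨PrePDHG.isProblem_example, PrePDHG.lagrangian_example, ?_⟩⟩
  -- The interval is nonempty exactly when ρ > 1/2: its left end gives 1 - σ < -1, its right end the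
  -- norm condition at τ = 1.
  obtain ⟨σ, hσ, hσ'⟩ : ∃ σ : ℝ, 2 < σ ∧ σ < 4 / 3 * (1 + ρ) := exists_between (by linarith)
  have hσ₀ : 0 < σ := by linarith
  have hμ : 1 - σ < -1 := by linarith
  have hgen := PrePDHG.isGenerated_example_iff one_pos hσ₀
  refine ⟨1, σ, one_pos, hσ₀,
    PrePDHG.paramCondition_example hσ₀ (by norm_num; linarith) (by norm_num; linarith), hgen,
    ⟨1 - σ, hμ, Module.End.hasEigenvalue_of_hasEigenvector (x := ![1, 2 * σ - 1]) ⟨?_, ?_⟩⟩,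
    -- The nonconvergent run is the orbit of the eigenvector (1, 2σ - 1).
    fun k => EuclideanSpace.single 0 ((1 - σ) ^ k),
    fun k => EuclideanSpace.single 0 ((1 - σ) ^ k * (2 * σ - 1)), (hgen _ _).2 fun k => ?_, ?_⟩
  · rw [Module.End.mem_eigenspace_iff, Matrix.toLin'_apply, PrePDHG.exIter_one_mulVec]
  · intro h
    simpa using congrFun h 0
  · have e : ∀ k : ℕ, ![(1 - σ) ^ k, (1 - σ) ^ k * (2 * σ - 1)] =
        (1 - σ) ^ k • ![1, 2 * σ - 1] := fun k => by simp
    simp only [PiLp.single_apply, if_true]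
    rw [e, e, Matrix.mulVec_smul, PrePDHG.exIter_one_mulVec, smul_smul, pow_succ]
  · rintro ⟨p, hp⟩
    have h0 : Continuous fun z : PrePDHG.E 1 × PrePDHG.E 1 => z.1 0 := by fun_prop
    refine PrePDHG.not_tendsto_pow hμ (p.1 0) ?_
    simpa [Function.comp_def] using (h0.tendsto p).comp hp
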